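/- Let $(S,\rho)$ be a separable metric space with its Borel $\sigma$-algebra, and let $\nu$ be a Borel measure on $S$ without atoms, i.e. $\nu(\{\zeta\})=0$ for all $\zeta\in S$. Let $S^\infty$ be the set of all finite subsets $x\subset S$, with the $\sigma$-algebra generated by the counting maps $N_A(x)=\#(x\cap A)$, $A\subset S$ Borel. On $S^\infty$ let $d_H$ be the Hausdorff distance $$d_H(x,y)=\max\Big\{\sup_{a\in x}\inf_{b\in y}\rho(a,b),\ \sup_{b\in y}\inf_{a\in x}\rho(a,b)\Big\},$$ with the conventions $d_H(\emptyset,\emptyset)=0$ and $d_H(\emptyset,x)=\infty$ for $x\neq\emptyset$, and let $B_{d_H}(x,\delta)=\{y\in S^\infty: d_H(x,y)\le\delta\}$. For an integrable function $\lambda:S\to[0,\infty)$, a random element $X$ of $S^\infty$ is a Poisson process with intensity $\lambda$ if, for every Borel set $A$, the number $\#(X\cap A)$ is a random variable with Poisson distribution of mean $\int_A\lambda\,d\nu$, and for disjoint Borel sets $A_1,\dots,A_n$ the variables $\#(X\cap A_1),\dots,\#(X\cap A_n)$ are independent. Let $(X,Y)$ be a random element of $S^\infty\times\{0,\dots,M\}$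 on a probability space $(\Omega,\mathcal A,\mathbb P)$. Let $\lambda_0,\dots,\lambda_M:S\to[0,\infty)$ be continuous functions such that, for every $j\in\{0,\dots,M\}$ with $\mathbb P(Y=j)>0$, $\lambda_j$ is $\nu$-integrable and, under the conditional probability $\mathbb P(\,\cdot\mid Y=j)$, $X$ is a Poisson process with intensity $\lambda_j$. Let $P_X$ be the law of $X$ and let $\eta:S^\infty\to\mathbb R$ be any measurable version of the regression function $\eta(x)=\mathbb E(Y\mid X=x)$. Then $\eta$ satisfies the Besicovitch condition on $(S^\infty,d_H)$: for $P_X$-almost every $x$ one has $P_X(B_{d_H}(x,\delta))>0$ for all $\delta>0$ and the inner limit below exists, and $$\lim_{\epsilon\to0^+}P_X\Big\{x:\ \lim_{\delta\to0^+}\frac1{P_X(B_{d_H}(x,\delta))}\int_{B_{d_H}(x,\delta)}|\eta(x)-\eta(y)|\,dP_X(y)>\epsilon\Big\}=0.$$ -/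

import Mathlib

open MeasureTheory ProbabilityTheory Filter Topology
open scoped ENNReal NNReal

/-- The space `S^∞` of finite subsets (configurations) of `S`. -/
@[ext]
structure Configuration (S : Type*) where
  points : Set S
  finite : points.Finite

/-- The number `N_A(x) = #(x ∩ A)` of points of the configuration `x` lying in `A`. -/
noncomputable def pointCount {S : Type*} (A : Set S) (x : Configuration S) : ℕ :=
  (x.points ∩ A).ncard

/-- The space of configurations carries the `σ`-algebra generated by the counting maps
`N_A`, for `A` a measurable subset of `S`. -/
noncomputable instance configurationMeasurableSpace (S : Type*) [MeasurableSpace S] :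
    MeasurableSpace (Configuration S) :=
  ⨆ (A : Set S) (_ : MeasurableSet A), MeasurableSpace.comap (pointCount A) ⊤

/-- The mean `μ(A) = ∫_A lam dν`. -/
noncomputable def meanCount {S : Type*} [MeasurableSpace S] (ν : Measure S)
    (lam : S → ℝ≥0) (A : Set S) : ℝ≥0∞ :=
  ∫⁻ ζ in A, (lam ζ : ℝ≥0∞) ∂ν

/-- `X` is, under the probability measure `P`, a Poisson process on `S` with integrable intensity
function `lam` with respect to `ν`. -/
structure IsPoissonProcess {S Ω : Type*} [MeasurableSpace S] [MeasurableSpace Ω]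
    (ν : Measure S) (lam : S → ℝ≥0) (X : Ω → Configuration S) (P : Measure Ω) : Prop where
  integrable : Integrable (fun ζ => (lam ζ : ℝ)) ν
  measurable_count : ∀ A : Set S, MeasurableSet A → Measurable (fun ω => pointCount A (X ω))
  indep_count : ∀ (n : ℕ) (A : Fin n → Set S), (∀ i, MeasurableSet (A i)) →
    (∀ i j, i ≠ j → Disjoint (A i) (A j)) →
    iIndepFun (fun (i : Fin n) (ω : Ω) => pointCount (A i) (X ω)) P
  poisson_count : ∀ A : Set S, MeasurableSet A →
    P.map (fun ω => pointCount A (X ω)) = poissonMeasure (meanCount ν lam A).toNNReal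

/-- The Hausdorff distance between configurations of `S`. It is finite between two nonempty
sets, and the distance between the empty set and a nonempty set is `∞`
(the value that `inf ∅ = ∞` gives), so that the empty configuration is an isolated point. -/
noncomputable def dH {S : Type*} [MetricSpace S] (x y : Configuration S) : ℝ≥0∞ :=
  Metric.hausdorffEDist x.points y.points

/-- The closed ball of centre `x` and radius `δ` for the extended distance `d`. -/
def closedBallOf {E : Type*} (d : E → E → ℝ≥0∞) (x : E) (δ : ℝ) : Set E :=
  {y | d x y ≤ ENNReal.ofReal δ}

/-- The quotient `(1 / P(B_d(x, δ))) ∫_{B_d(x, δ)} |η(x) - η(y)| dP(y)`. -/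
noncomputable def meanDeviation {E : Type*} [MeasurableSpace E] (d : E → E → ℝ≥0∞)
    (P : Measure E) (η : E → ℝ) (x : E) (δ : ℝ) : ℝ≥0∞ :=
  (∫⁻ y in closedBallOf d x δ, ENNReal.ofReal |η x - η y| ∂P) / P (closedBallOf d x δ)

/-- The Besicovitch condition
`lim_{ε → 0} P {x : lim_{δ → 0} (1 / P(B_d(x, δ))) ∫_{B_d(x, δ)} |η(x) - η(y)| dP(y) > ε} = 0`,
where it is part of the condition that, for `P`-almost every `x`, the quotients have a nonzero
denominator and the inner limit exists. -/
def BesicovitchCondition {E : Type*} [MeasurableSpace E] (d : E → E → ℝ≥0∞)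
    (P : Measure E) (η : E → ℝ) : Prop :=
  (∀ᵐ x ∂P, (∀ δ : ℝ, 0 < δ → 0 < P (closedBallOf d x δ)) ∧
    ∃ L : ℝ≥0∞, Tendsto (meanDeviation d P η x) (𝓝[>] 0) (𝓝 L)) ∧
  Tendsto (fun ε : ℝ => P {x | ∃ L : ℝ≥0∞,
    Tendsto (meanDeviation d P η x) (𝓝[>] 0) (𝓝 L) ∧ ENNReal.ofReal ε < L}) (𝓝[>] 0) (𝓝 0)

/-- `η` is a version of the regression function `x ↦ E(Y | X = x)`. -/
def IsRegressionFunction {Ω E : Type*} [MeasurableSpace Ω] [mE : MeasurableSpace E]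
    (P : Measure Ω) (X : Ω → E) (Y : Ω → ℝ) (η : E → ℝ) : Prop :=
  Measurable η ∧ (fun ω => η (X ω)) =ᵐ[P] P[Y | MeasurableSpace.comap X mE]

/-!
Write `μ_j = lam j • ν`, and let `P_j` be the law of `X` given `Y = j`.

* **Densities.** The void events `{x | x ∩ A = ∅}` form a `π`-system that generates the
  `σ`-algebra of configurations (`generateFrom_voidEvent`), so a law is determined by its void
  probabilities. Let `R = ∑ₙ μ^n / n!` be the Lebesgue–Poisson measure of an atomless s-finite
  measure `μ`. Its Laplace functional is `∫ ∏_{ζ ∈ x} g ζ dR = exp (∫ g dμ)`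
  (`lintegral_pointProd_lebesguePoisson`). Replacing `g` by `1_{Aᶜ} lam j` gives the void
  probabilities of the measure with density `exp (-μ_j S) ∏_{ζ ∈ x} lam j ζ`, which are those of a
  Poisson process; hence this is the density of `P_j`
  (`IsPoissonProcess.map_eq_withDensity`). As `ν` need not be s-finite, `μ` is the restriction of
  `ν` to the set where some intensity is positive.
* **The regression function.** By Bayes' formula (`posteriorMean_ae_eq_condExp`), `η` agrees almost
  everywhere with a quotient of linear combinations of the products `∏_{ζ ∈ x} lam j ζ`. These
  products are continuous in the Hausdorff distance among configurations with a fixed number of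
  points (`tendsto_pointProd`).
* **Small balls.** When `δ` is so small that the balls `B(a, δ)`, `a ∈ x`, are disjoint, the
  Hausdorff ball `B(x, δ)` consists of the configurations that charge each `B(a, δ)` and nothing
  else, so independence expresses its probability as a product. A Poisson variable of mean `m` has
  `P(N ≥ 2) ≤ m P(N ≥ 1)`, and so within `B(x, δ)` the configurations whose number of points
  differs from that of `x` have relative probability at most `∑_{a ∈ x} μ_j (B(a, δ))`
  (`IsPoissonProcess.map_closedBallOf_inter_le`), which vanishes as `δ → 0` because `ν` has no
  atoms. The product is positive when all points of `x` lie in the support of `μ_j`, as they almost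
  surely do.

So `η` agrees almost everywhere with a bounded function that, for almost every `x`, is continuous
at `x` along configurations with as many points as `x`, while the other configurations are
negligible near `x`: the mean deviation tends to `0` (`tendsto_meanDeviation`).
-/

/-! ### The `σ`-algebra of configurations -/

section Void

variable {S : Type*}

/-- The void event of `A`: the configurations without a point in `A`. -/
def voidEvent (A : Set S) : Set (Configuration S) := {x | Disjoint x.points A}

/-- The configuration obtained by adding the point `ζ` (which may already be present). -/
def insertPoint (x : Configuration S) (ζ : S) : Configuration S :=
  ⟨insert ζ x.points, x.finite.insert ζ⟩

/-- The product of the values of `g` at the points of a configuration. -/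
noncomputable def pointProd (g : S → ℝ≥0) (x : Configuration S) : ℝ≥0 :=
  ∏ ζ ∈ x.finite.toFinset, g ζ

lemma pointCount_eq_zero_iff {A : Set S} {x : Configuration S} :
    pointCount A x = 0 ↔ x ∈ voidEvent A := by
  rw [pointCount, Set.ncard_eq_zero (x.finite.inter_of_left A), voidEvent, Set.mem_ofPred_eq,
    Set.disjoint_iff_inter_eq_empty]

lemma voidEvent_inter_voidEvent (A B : Set S) :
    voidEvent A ∩ voidEvent B = voidEvent (A ∪ B) := by
  ext x
  simp [voidEvent]

lemma voidEvent_empty : voidEvent (∅ : Set S) = Set.univ := by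
  ext x
  simp [voidEvent]

lemma insertPoint_mem_voidEvent {A : Set S} {x : Configuration S} {ζ : S} :
    insertPoint x ζ ∈ voidEvent A ↔ x ∈ voidEvent A ∧ ζ ∉ A := by
  simp only [voidEvent, insertPoint, Set.mem_ofPred_eq, Set.disjoint_insert_left]
  tauto

lemma pointProd_insertPoint (g : S → ℝ≥0) {x : Configuration S} {ζ : S} (h : ζ ∉ x.points) :
    pointProd g (insertPoint x ζ) = pointProd g x * g ζ := by
  classical
  have h1 : (insertPoint x ζ).finite.toFinset = insert ζ x.finite.toFinset := by
    ext z
    simp [insertPoint]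
  rw [pointProd, h1, Finset.prod_insert (by simpa using h), mul_comm, pointProd]

lemma pointProd_indicator_compl (g : S → ℝ≥0) (A : Set S) (x : Configuration S) :
    pointProd (Aᶜ.indicator g) x = (voidEvent A).indicator (pointProd g) x := by
  classical
  by_cases hx : x ∈ voidEvent A
  · rw [Set.indicator_of_mem hx]
    refine Finset.prod_congr rfl fun ζ hζ => Set.indicator_of_mem ?_ _
    exact Set.disjoint_left.1 hx (by simpa using hζ)
  · rw [Set.indicator_of_notMem hx]
    obtain ⟨ζ, hζ, hA⟩ := Set.not_disjoint_iff.1 hx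
    exact Finset.prod_eq_zero (i := ζ) (by simpa using hζ) (by simp [hA])

variable [MeasurableSpace S]

lemma measurable_pointCount {A : Set S} (hA : MeasurableSet A) :
    Measurable (pointCount A) := by
  have h : Measurable[MeasurableSpace.comap (pointCount A) ⊤] (pointCount A) :=
    comap_measurable _
  exact h.mono (le_iSup₂_of_le A hA le_rfl) le_rfl

lemma measurableSet_voidEvent {A : Set S} (hA : MeasurableSet A) :
    MeasurableSet (voidEvent A) := by
  have : voidEvent A = pointCount A ⁻¹' {0} := by
    ext x
    simp [← pointCount_eq_zero_iff]
  rw [this]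
  exact measurable_pointCount hA (measurableSet_singleton 0)

lemma isPiSystem_voidEvent :
    IsPiSystem {V : Set (Configuration S) | ∃ A, MeasurableSet A ∧ voidEvent A = V} := by
  rintro _ ⟨A, hA, rfl⟩ _ ⟨B, hB, rfl⟩ -
  exact ⟨A ∪ B, hA.union hB, (voidEvent_inter_voidEvent A B).symm⟩

/-- A function of a configuration that is multiplicative over the points is measurable: for simple
functions it is a monomial in the counts of the level sets. -/
lemma measurable_pointProd {g : S → ℝ≥0} (hg : Measurable g) :
    Measurable (pointProd g) := by
  have simple : ∀ f : SimpleFunc S ℝ≥0, Measurable (pointProd f) := by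
    intro f
    have h : pointProd f = fun x => ∏ c ∈ f.range, c ^ pointCount (f ⁻¹' {c}) x := by
      classical
      ext1 x
      rw [pointProd, ← Finset.prod_fiberwise_of_maps_to' (t := f.range) (g := f)
        (fun ζ _ => f.mem_range_self ζ) fun c => c]
      refine Finset.prod_congr rfl fun c _ => ?_
      rw [Finset.prod_const, pointCount, ← Set.ncard_coe_finset]
      congr 2
      ext ζ
      simp
    rw [h]
    exact Finset.measurable_prod _ fun c _ =>
      (measurable_of_countable (fun n : ℕ => c ^ n)).comp
        (measurable_pointCount (f.measurableSet_fiber c))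
  obtain ⟨f, hf⟩ : ∃ f : ℕ → SimpleFunc S ℝ≥0, ∀ ζ, Tendsto (fun n => f n ζ) atTop (𝓝 (g ζ)) :=
    ⟨_, fun ζ => hg.stronglyMeasurable.tendsto_approx ζ⟩
  refine measurable_of_tendsto_metrizable (fun n => simple (f n)) (tendsto_pi_nhds.2 fun x => ?_)
  exact tendsto_finsetProd _ fun ζ _ => hf ζ

end Void

section Renyi

variable {S : Type*}

/-- A configuration has at least `k` points in `A` exactly when it charges `A ∩ U i` for `k`
pairwise disjoint sets `U i` of a countable basis. -/
lemma le_pointCount_iff [MetricSpace S] {b : Set (Set S)} (hb : TopologicalSpace.IsTopologicalBasis b)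
    (A : Set S) (k : ℕ) (x : Configuration S) :
    k ≤ pointCount A x ↔ ∃ U : Fin k → b, Pairwise (fun i j => Disjoint (U i : Set S) (U j)) ∧
      ∀ i, x ∉ voidEvent (A ∩ U i) := by
  constructor
  · intro h
    obtain ⟨t, ht, hk⟩ := Set.exists_subset_card_eq h
    have htf : t.Finite := (x.finite.inter_of_left A).subset ht
    obtain ⟨V, hV, hd⟩ := htf.t2_separation
    have : Finite t := htf
    have e : Fin k ≃ t := (Finite.equivFinOfCardEq (by rw [← hk]; rfl)).symm
    choose W hWb hW hWV using fun ζ : S => hb.exists_subset_of_mem_open (hV ζ).1 (hV ζ).2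
    refine ⟨fun i => ⟨W (e i), hWb _⟩, fun i j hij => ?_, fun i => ?_⟩
    · refine (hd (e i).2 (e j).2 fun h => hij (e.injective (Subtype.ext h))).mono
        (hWV _) (hWV _)
    · exact Set.not_disjoint_iff.2 ⟨e i, (ht (e i).2).1, (ht (e i).2).2, hW _⟩
  · rintro ⟨U, hU, hx⟩
    choose z hz hzA using fun i => Set.not_disjoint_iff.1 (hx i)
    have hinj : Function.Injective z := by
      intro i j hij
      by_contra hne
      exact Set.disjoint_left.1 (hU hne) (hzA i).2 (hij ▸ (hzA j).2)
    have : (Set.range z).ncard = k := by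
      rw [← Set.image_univ, Set.ncard_image_of_injective _ hinj, Set.ncard_univ, Nat.card_fin]
    rw [← this]
    refine Set.ncard_le_ncard ?_ (x.finite.inter_of_left A)
    rintro _ ⟨i, rfl⟩
    exact ⟨hz i, (hzA i).1⟩

variable [MetricSpace S] [TopologicalSpace.SeparableSpace S] [MeasurableSpace S] [BorelSpace S]

/-- Void events generate the `σ`-algebra of configurations (Rényi). -/
lemma generateFrom_voidEvent :
    configurationMeasurableSpace S = MeasurableSpace.generateFrom
      {V : Set (Configuration S) | ∃ A, MeasurableSet A ∧ voidEvent A = V} := by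
  apply le_antisymm
  · refine iSup₂_le fun A hA => ?_
    rw [← measurable_iff_comap_le]
    have : SecondCountableTopology S := UniformSpace.secondCountable_of_separable S
    obtain ⟨b, hbc, -, hb⟩ := TopologicalSpace.exists_countable_basis S
    have : Countable b := hbc
    suffices h : ∀ k, MeasurableSet[MeasurableSpace.generateFrom
        {V : Set (Configuration S) | ∃ A, MeasurableSet A ∧ voidEvent A = V}]
        (pointCount A ⁻¹' Set.Ici k) from measurable_of_Ici h
    intro k
    have : pointCount A ⁻¹' Set.Ici k = ⋃ U : Fin k → b,
        ⋃ _ : Pairwise (fun i j => Disjoint (U i : Set S) (U j)),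
          ⋂ i, (voidEvent (A ∩ U i))ᶜ := by
      ext x
      simp only [Set.mem_preimage, Set.mem_Ici, le_pointCount_iff hb, Set.mem_iUnion,
        Set.mem_iInter, Set.mem_compl_iff, exists_prop]
    rw [this]
    refine .iUnion fun U => .iUnion fun _ => .iInter
      fun i => .compl ?_
    exact MeasurableSpace.measurableSet_generateFrom
      ⟨_, hA.inter (hb.isOpen (U i).2).measurableSet, rfl⟩
  · refine MeasurableSpace.generateFrom_le ?_
    rintro _ ⟨A, hA, rfl⟩
    exact measurableSet_voidEvent hA

lemma measurable_insertPoint :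
    Measurable (fun p : Configuration S × S => insertPoint p.1 p.2) := by
  suffices h : ∀ V ∈ {V : Set (Configuration S) | ∃ A, MeasurableSet A ∧ voidEvent A = V},
      MeasurableSet ((fun p : Configuration S × S => insertPoint p.1 p.2) ⁻¹' V) by
    have := measurable_generateFrom h
    rwa [← generateFrom_voidEvent] at this
  rintro _ ⟨A, hA, rfl⟩
  have : (fun p : Configuration S × S => insertPoint p.1 p.2) ⁻¹' voidEvent A
      = voidEvent A ×ˢ Aᶜ := by
    ext p
    simp [insertPoint_mem_voidEvent]
  rw [this]
  exact (measurableSet_voidEvent hA).prod hA.compl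

end Renyi

/-! ### The Lebesgue–Poisson measure -/

section LebesguePoisson

variable {S : Type*} [MeasurableSpace S]

/-- The image of the `n`-fold product measure `μ^n` under `(ζ₁, …, ζₙ) ↦ {ζ₁, …, ζₙ}`, obtained by
adding one `μ`-distributed point after the other. -/
noncomputable def tupleMeasure (μ : Measure S) : ℕ → Measure (Configuration S)
  | 0 => Measure.dirac ⟨∅, Set.finite_empty⟩
  | n + 1 => ((tupleMeasure μ n).prod μ).map fun p => insertPoint p.1 p.2

/-- The Lebesgue–Poisson measure `∑ₙ μ^n / n!` on configurations. -/
noncomputable def lebesguePoisson (μ : Measure S) : Measure (Configuration S) :=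
  Measure.sum fun n => ENNReal.ofReal ((n.factorial : ℝ)⁻¹) • tupleMeasure μ n

instance (μ : Measure S) [SFinite μ] (n : ℕ) : SFinite (tupleMeasure μ n) := by
  induction n with
  | zero => exact inferInstanceAs (SFinite (Measure.dirac _))
  | succ n ih => exact inferInstanceAs (SFinite (Measure.map _ _))

lemma IsPoissonProcess.meanCount_ne_top {Ω : Type*} [MeasurableSpace Ω] {ν : Measure S}
    {lam : S → ℝ≥0} {X : Ω → Configuration S} {P : Measure Ω}
    (h : IsPoissonProcess ν lam X P) (A : Set S) : meanCount ν lam A ≠ ∞ := by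
  have h1 := h.integrable.lintegral_lt_top
  simp only [ENNReal.ofReal_coe_nnreal] at h1
  exact ((setLIntegral_le_lintegral A _).trans_lt h1).ne

lemma IsPoissonProcess.measure_pointCount_eq {Ω : Type*} [MeasurableSpace Ω] {ν : Measure S}
    {lam : S → ℝ≥0} {X : Ω → Configuration S} {P : Measure Ω}
    (h : IsPoissonProcess ν lam X P) {A : Set S} (hA : MeasurableSet A) (N : Set ℕ) :
    P {ω | pointCount A (X ω) ∈ N} = poissonMeasure (meanCount ν lam A).toNNReal N := by
  rw [← h.poisson_count A hA, Measure.map_apply (h.measurable_count A hA) (.of_discrete)]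
  rfl

variable [MetricSpace S] [TopologicalSpace.SeparableSpace S] [BorelSpace S]
    {μ : Measure S} [SFinite μ]

/-- Since `μ` has no atoms, a further point almost surely differs from the finitely many earlier
ones, so it contributes a factor of its own. -/
lemma lintegral_pointProd_tupleMeasure (hμ : ∀ ζ, μ {ζ} = 0) {g : S → ℝ≥0} (hg : Measurable g)
    (n : ℕ) : ∫⁻ x, pointProd g x ∂(tupleMeasure μ n) = (∫⁻ ζ, g ζ ∂μ) ^ n := by
  have hG : Measurable fun x : Configuration S => (pointProd g x : ℝ≥0∞) :=
    (measurable_pointProd hg).coe_nnreal_ennreal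
  induction n with
  | zero =>
    rw [tupleMeasure, lintegral_dirac' _ hG]
    simp [pointProd]
  | succ n ih =>
    rw [tupleMeasure, lintegral_map hG measurable_insertPoint,
      lintegral_prod (fun p : Configuration S × S => (pointProd g (insertPoint p.1 p.2) : ℝ≥0∞))
        (hG.comp measurable_insertPoint).aemeasurable]
    have h : ∀ x : Configuration S, ∫⁻ ζ, (pointProd g (insertPoint x ζ) : ℝ≥0∞) ∂μ
        = pointProd g x * ∫⁻ ζ, g ζ ∂μ := by
      intro x
      rw [← lintegral_const_mul _ hg.coe_nnreal_ennreal]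
      refine lintegral_congr_ae ?_
      have hx : μ x.points = 0 := by
        rw [← Set.biUnion_of_singleton x.points]
        exact (measure_biUnion_null_iff x.finite.countable).2 fun ζ _ => hμ ζ
      filter_upwards [measure_eq_zero_iff_ae_notMem.1 hx] with ζ hζ
      rw [pointProd_insertPoint g hζ, ENNReal.coe_mul]
    simp only [h]
    rw [lintegral_mul_const _ hG, ih, pow_succ]

/-- The Laplace functional of the Lebesgue–Poisson measure. -/
lemma lintegral_pointProd_lebesguePoisson (hμ : ∀ ζ, μ {ζ} = 0) {g : S → ℝ≥0}
    (hg : Measurable g) (hfin : ∫⁻ ζ, g ζ ∂μ ≠ ∞) :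
    ∫⁻ x, pointProd g x ∂(lebesguePoisson μ)
      = ENNReal.ofReal (Real.exp (∫⁻ ζ, g ζ ∂μ).toReal) := by
  rw [lebesguePoisson, lintegral_sum_measure]
  simp only [lintegral_smul_measure, lintegral_pointProd_tupleMeasure hμ hg, smul_eq_mul]
  generalize ∫⁻ ζ, g ζ ∂μ = c at hfin
  lift c to ℝ≥0 using hfin
  have h := NormedSpace.expSeries_div_hasSum_exp (c : ℝ)
  rw [← Real.exp_eq_exp_ℝ] at h
  rw [ENNReal.coe_toReal, ← h.tsum_eq,
    ENNReal.ofReal_tsum_of_nonneg (fun n => by positivity) h.summable]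
  refine tsum_congr fun n => ?_
  rw [div_eq_inv_mul, ENNReal.ofReal_mul (by positivity), ENNReal.ofReal_pow (by positivity),
    ENNReal.ofReal_coe_nnreal]

/-- The law of a Poisson process has the density `exp (-∫ lam) ∏_{ζ ∈ x} lam ζ` with respect to the
Lebesgue–Poisson measure of any reference measure that represents its mean measure: both sides have
the same void probabilities. -/
lemma IsPoissonProcess.map_eq_withDensity {Ω : Type*} [MeasurableSpace Ω] {ν : Measure S}
    {lam : S → ℝ≥0} {X : Ω → Configuration S} {P : Measure Ω} [IsProbabilityMeasure P]
    (hX : Measurable X) (h : IsPoissonProcess ν lam X P) (hlam : Measurable lam)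
    (hμ : ∀ ζ, μ {ζ} = 0)
    (hmean : ∀ A, MeasurableSet A → ∫⁻ ζ in A, lam ζ ∂μ = meanCount ν lam A) :
    P.map X = (lebesguePoisson μ).withDensity fun x =>
      ENNReal.ofReal (Real.exp (-(meanCount ν lam Set.univ).toReal)) * pointProd lam x := by
  set m := (meanCount ν lam Set.univ).toReal with hm
  have hG : Measurable fun x : Configuration S => (pointProd lam x : ℝ≥0∞) :=
    (measurable_pointProd hlam).coe_nnreal_ennreal
  have void : ∀ A, MeasurableSet A → P.map X (voidEvent A) =
      ((lebesguePoisson μ).withDensity fun x =>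
        ENNReal.ofReal (Real.exp (-m)) * pointProd lam x) (voidEvent A) := by
    intro A hA
    have hV := measurableSet_voidEvent hA
    have hAc : ∫⁻ ζ, (Aᶜ.indicator lam ζ : ℝ≥0) ∂μ = meanCount ν lam Aᶜ := by
      rw [← hmean _ hA.compl, ← lintegral_indicator hA.compl]
      refine lintegral_congr fun ζ => ?_
      by_cases hζ : ζ ∈ A <;> simp [hζ]
    have hadd : m = (meanCount ν lam A).toReal + (meanCount ν lam Aᶜ).toReal := by
      rw [← ENNReal.toReal_add (h.meanCount_ne_top _) (h.meanCount_ne_top _), hm, meanCount,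
        meanCount, meanCount, lintegral_add_compl _ hA, Measure.restrict_univ]
    have hleft : P.map X (voidEvent A) =
        ENNReal.ofReal (Real.exp (-(meanCount ν lam A).toReal)) := by
      have h1 : X ⁻¹' voidEvent A = {ω | pointCount A (X ω) ∈ ({0} : Set ℕ)} := by
        ext ω
        simp [pointCount_eq_zero_iff]
      rw [Measure.map_apply hX hV, h1, h.measure_pointCount_eq hA, poissonMeasure_singleton]
      simp [ENNReal.toReal]
    have hright : ∫⁻ x in voidEvent A, (pointProd lam x : ℝ≥0∞) ∂(lebesguePoisson μ) =
        ENNReal.ofReal (Real.exp (meanCount ν lam Aᶜ).toReal) := by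
      rw [← hAc, ← lintegral_pointProd_lebesguePoisson hμ (hlam.indicator hA.compl)
        (by rw [hAc]; exact h.meanCount_ne_top _), ← lintegral_indicator hV]
      refine lintegral_congr fun x => ?_
      rw [pointProd_indicator_compl]
      by_cases hx : x ∈ voidEvent A <;> simp [hx]
    rw [hleft, withDensity_apply _ hV, lintegral_const_mul _ hG, hright,
      ← ENNReal.ofReal_mul (by positivity), ← Real.exp_add, hadd]
    congr 2
    ring
  have := Measure.isProbabilityMeasure_map (μ := P) hX.aemeasurable
  refine ext_of_generate_finite _ generateFrom_voidEvent isPiSystem_voidEvent ?_ ?_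
  · rintro _ ⟨A, hA, rfl⟩
    exact void A hA
  · simpa only [voidEvent_empty] using void ∅ MeasurableSet.empty

end LebesguePoisson

/-! ### Hausdorff balls around a configuration -/

section Balls

variable {S : Type*} [MetricSpace S]

lemma exists_dist_le_of_infEDist_le {s : Set S} (hs : s.Finite) {b : S} {δ : ℝ} (hδ : 0 ≤ δ)
    (h : Metric.infEDist b s ≤ ENNReal.ofReal δ) : ∃ a ∈ s, dist b a ≤ δ := by
  rcases s.eq_empty_or_nonempty with rfl | hne
  · simp at h
  obtain ⟨a, ha, hba⟩ := hs.isCompact.exists_infEDist_eq_edist hne b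
  rw [hba, edist_dist] at h
  exact ⟨a, ha, (ENNReal.ofReal_le_ofReal_iff hδ).1 h⟩

/-- A Hausdorff ball imposes that every point lies near a point of the centre, and that every point
of the centre is approached. -/
lemma mem_closedBallOf_dH_iff {x y : Configuration S} {δ : ℝ} (hδ : 0 ≤ δ) :
    y ∈ closedBallOf dH x δ ↔ y ∈ voidEvent (⋃ a : x.points, Metric.closedBall (a : S) δ)ᶜ ∧
      ∀ a : x.points, pointCount (Metric.closedBall (a : S) δ) y ≠ 0 := by
  have h1 : y ∈ voidEvent (⋃ a : x.points, Metric.closedBall (a : S) δ)ᶜ ↔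
      ∀ b ∈ y.points, ∃ a ∈ x.points, dist b a ≤ δ := by
    rw [voidEvent, Set.mem_ofPred_eq, Set.disjoint_compl_right_iff_subset]
    simp [Set.subset_def]
  have h2 : (∀ a : x.points, pointCount (Metric.closedBall (a : S) δ) y ≠ 0) ↔
      ∀ a ∈ x.points, ∃ b ∈ y.points, dist b a ≤ δ := by
    simp [pointCount_eq_zero_iff, voidEvent, Set.not_disjoint_iff]
  rw [h1, h2]
  constructor
  · intro h
    have hle : Metric.hausdorffEDist x.points y.points ≤ ENNReal.ofReal δ := h
    refine ⟨fun b hb => exists_dist_le_of_infEDist_le x.finite hδ ?_, fun a ha => ?_⟩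
    · rw [Metric.hausdorffEDist_comm] at hle
      exact (Metric.infEDist_le_hausdorffEDist_of_mem hb).trans hle
    · obtain ⟨b, hb, hab⟩ := exists_dist_le_of_infEDist_le y.finite hδ
        ((Metric.infEDist_le_hausdorffEDist_of_mem ha).trans hle)
      exact ⟨b, hb, by rwa [dist_comm]⟩
  · rintro ⟨h3, h4⟩
    refine Metric.hausdorffEDist_le_of_mem_edist (fun a ha => ?_) fun b hb => ?_
    · obtain ⟨b, hb, hab⟩ := h4 a ha
      exact ⟨b, hb, by rw [edist_comm, edist_dist]; exact ENNReal.ofReal_le_ofReal hab⟩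
    · obtain ⟨a, ha, hab⟩ := h3 b hb
      exact ⟨a, ha, by rw [edist_dist]; exact ENNReal.ofReal_le_ofReal hab⟩

lemma closedBallOf_mono {E : Type*} (d : E → E → ℝ≥0∞) (x : E) {δ δ' : ℝ} (h : δ ≤ δ') :
    closedBallOf d x δ ⊆ closedBallOf d x δ' :=
  fun _ hy => le_trans hy (ENNReal.ofReal_le_ofReal h)

lemma measurableSet_closedBallOf_dH [MeasurableSpace S] [BorelSpace S] (x : Configuration S)
    {δ : ℝ} (hδ : 0 ≤ δ) : MeasurableSet (closedBallOf dH x δ) := by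
  have : Finite x.points := x.finite
  have h : closedBallOf dH x δ = voidEvent (⋃ a : x.points, Metric.closedBall (a : S) δ)ᶜ ∩
      ⋂ a : x.points, pointCount (Metric.closedBall (a : S) δ) ⁻¹' {0}ᶜ := by
    ext y
    simp [mem_closedBallOf_dH_iff hδ]
  rw [h]
  refine (measurableSet_voidEvent (MeasurableSet.iUnion fun a => ?_).compl).inter
    (MeasurableSet.iInter fun a => measurable_pointCount ?_ (.of_discrete))
  all_goals exact Metric.isClosed_closedBall.measurableSet

lemma eventually_disjoint_closedBall (x : Configuration S) :
    ∀ᶠ δ in 𝓝[>] (0 : ℝ), Pairwise fun a b : x.points =>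
      Disjoint (Metric.closedBall (a : S) δ) (Metric.closedBall (b : S) δ) := by
  have : Finite x.points := x.finite
  refine eventually_all.2 fun a => eventually_all.2 fun b => eventually_imp_distrib_left.2 ?_
  intro hab
  have hd : 0 < dist (a : S) b / 2 := half_pos (dist_pos.2 fun h => hab (Subtype.ext h))
  filter_upwards [Ioo_mem_nhdsGT hd] with δ hδ
  exact Metric.closedBall_disjoint_closedBall (by linarith [hδ.2])

/-- The number of points of a configuration. -/
noncomputable def numPoints (x : Configuration S) : ℕ := x.points.ncard

omit [MetricSpace S] in
lemma numPoints_eq_of_pointCount_eq_one {ι : Type*} [Finite ι] {B : ι → Set S}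
    (hB : Pairwise fun i j => Disjoint (B i) (B j)) {y : Configuration S}
    (hy : y ∈ voidEvent (⋃ i, B i)ᶜ) (h1 : ∀ i, pointCount (B i) y = 1) :
    numPoints y = Nat.card ι := by
  choose s hs using fun i => Set.ncard_eq_one.1 (h1 i)
  have hmem : ∀ i, s i ∈ y.points ∩ B i := fun i => by rw [hs i]; rfl
  have hinj : Function.Injective s := by
    intro i j hij
    by_contra hne
    exact Set.disjoint_left.1 (hB hne) (hmem i).2 (hij ▸ (hmem j).2)
  have hrange : y.points = Set.range s := by
    ext b
    constructor
    · intro hb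
      obtain ⟨i, hi⟩ := Set.mem_iUnion.1 (Set.disjoint_compl_right_iff_subset.1 hy hb)
      have : b ∈ y.points ∩ B i := ⟨hb, hi⟩
      rw [hs i] at this
      exact ⟨i, this.symm⟩
    · rintro ⟨i, rfl⟩
      exact (hmem i).1
  rw [numPoints, hrange, ← Set.image_univ, Set.ncard_image_of_injective _ hinj, Set.ncard_univ]

/-- The filter of configurations that converge to `x` in the Hausdorff distance while keeping the
number of points of `x`. -/
noncomputable def nhdsSameCard (x : Configuration S) : Filter (Configuration S) :=
  comap (dH x) (𝓝 0) ⊓ 𝓟 {y | numPoints y = numPoints x}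

lemma exists_of_eventually_nhdsSameCard {x : Configuration S} {p : Configuration S → Prop}
    (h : ∀ᶠ y in nhdsSameCard x, p y) :
    ∃ δ₀ > 0, ∀ y ∈ closedBallOf dH x δ₀, numPoints y = numPoints x → p y := by
  rw [nhdsSameCard, eventually_inf_principal] at h
  obtain ⟨ε, hε, h⟩ := (ENNReal.nhds_zero_basis_Iic.comap (dH x)).eventually_iff.1 h
  obtain ⟨δ, hδ, hδε⟩ : ∃ δ : ℝ, 0 < δ ∧ ENNReal.ofReal δ ≤ ε := by
    obtain ⟨r, hr, hrε⟩ := ENNReal.lt_iff_exists_nnreal_btwn.1 hε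
    exact ⟨r, by exact_mod_cast hr, by simpa using hrε.le⟩
  exact ⟨δ, hδ, fun y hy => h (le_trans hy hδε)⟩

lemma eventually_mem_closedBallOf_nhdsSameCard (x : Configuration S) {δ : ℝ} (hδ : 0 < δ) :
    ∀ᶠ y in nhdsSameCard x, y ∈ closedBallOf dH x δ ∧ numPoints y = numPoints x := by
  refine Eventually.and ?_ ?_
  · exact mem_inf_of_left (preimage_mem_comap (Iic_mem_nhds (ENNReal.ofReal_pos.2 hδ)))
  · exact mem_inf_of_right (mem_principal_self _)

/-- For a fixed number of points, products over the points of a continuous function are continuous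
in the Hausdorff distance: close to `x`, the points of a configuration with as many points as `x`
are matched bijectively with nearby points of `x`. -/
lemma tendsto_pointProd {g : S → ℝ≥0} (hg : Continuous g) (x : Configuration S) :
    Tendsto (pointProd g) (nhdsSameCard x) (𝓝 (pointProd g x)) := by
  classical
  have : Fintype x.points := x.finite.fintype
  have hprod : ∀ (y : Configuration S) (s : x.points → S), Function.Injective s →
      Set.range s = y.points → pointProd g y = ∏ a, g (s a) := by
    intro y s hs hr
    rw [pointProd, ← Finset.prod_image (s := Finset.univ) (g := s) (f := g)
      (fun a _ b _ h => hs h)]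
    congr 1
    ext z
    simp [← hr]
  have hcont : ContinuousAt (fun s : x.points → S => ∏ a, g (s a)) (fun a => (a : S)) := by
    exact (continuous_finsetProd _ fun a _ => hg.comp (continuous_apply a)).continuousAt
  rw [ContinuousAt, ← hprod x _ Subtype.val_injective Subtype.range_coe] at hcont
  intro V hV
  obtain ⟨ε, hε, hV⟩ := Metric.mem_nhds_iff.1 (hcont hV)
  obtain ⟨δ, hdisj, hδ⟩ :=
    ((eventually_disjoint_closedBall x).and (Ioo_mem_nhdsGT hε)).exists
  change ∀ᶠ y in nhdsSameCard x, pointProd g y ∈ V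
  filter_upwards [eventually_mem_closedBallOf_nhdsSameCard x hδ.1] with y hy
  have hmem := ((mem_closedBallOf_dH_iff hδ.1.le).1 hy.1).2
  simp only [ne_eq, pointCount_eq_zero_iff, voidEvent, Set.mem_ofPred_eq,
    Set.not_disjoint_iff] at hmem
  choose s hsy hsB using hmem
  have hinj : Function.Injective s := by
    intro a b hab
    by_contra hne
    exact Set.disjoint_left.1 (hdisj hne) (hsB a) (hab ▸ hsB b)
  have hrange : Set.range s = y.points := by
    refine Set.eq_of_subset_of_ncard_le (by rintro _ ⟨a, rfl⟩; exact hsy a) ?_ y.finite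
    rw [← Set.image_univ, Set.ncard_image_of_injective _ hinj, Set.ncard_univ]
    exact hy.2.le
  rw [hprod y s hinj hrange]
  refine hV (show s ∈ Metric.ball _ ε from ?_)
  exact (dist_pi_lt_iff hε).2 fun a => (Metric.mem_closedBall.1 (hsB a)).trans_lt hδ.2

end Balls

/-! ### Hausdorff balls under a Poisson law -/

section Poisson

lemma poissonMeasure_compl_zero (r : ℝ≥0) :
    poissonMeasure r {0}ᶜ = ENNReal.ofReal (1 - Real.exp (-r)) := by
  rw [← ofReal_measureReal, probReal_compl_eq_one_sub (.of_discrete),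
    poissonMeasure_real_singleton]
  simp

/-- For a small mean, several points are much less likely than at least one point. -/
lemma poissonMeasure_Ici_two_le (r : ℝ≥0) :
    poissonMeasure r (Set.Ici 2) ≤ r * poissonMeasure r {0}ᶜ := by
  have h : (Set.Ici 2 : Set ℕ) = ({0} ∪ {1})ᶜ := by
    ext n
    simp
    omega
  rw [poissonMeasure_compl_zero, ← ofReal_measureReal, h,
    probReal_compl_eq_one_sub (.of_discrete), measureReal_union (by simp) (.of_discrete),
    poissonMeasure_real_singleton, poissonMeasure_real_singleton, ← ENNReal.ofReal_coe_nnreal,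
    ← ENNReal.ofReal_mul (by positivity)]
  refine ENNReal.ofReal_le_ofReal ?_
  have := Real.add_one_le_exp (-(r : ℝ))
  simp
  nlinarith

variable {S Ω : Type*} [MeasurableSpace Ω] [MeasurableSpace S] {ν : Measure S}
    {lam : S → ℝ≥0} {X : Ω → Configuration S} {P : Measure Ω}

lemma IsPoissonProcess.measure_forall_pointCount_mem {ι : Type*} [Fintype ι]
    (h : IsPoissonProcess ν lam X P) {A : ι → Set S} (hA : ∀ i, MeasurableSet (A i))
    (hd : Pairwise fun i j => Disjoint (A i) (A j)) (N : ι → Set ℕ) :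
    P {ω | ∀ i, pointCount (A i) (X ω) ∈ N i} =
      ∏ i, poissonMeasure (meanCount ν lam (A i)).toNNReal (N i) := by
  have e := Fintype.equivFin ι
  have hind := (h.indep_count _ (fun i => A (e.symm i)) (fun i => hA _)
    (fun i j hij => hd fun h => hij (e.symm.injective h))).precomp e.injective
  have h1 := hind.measure_inter_preimage_eq_mul Finset.univ (sets := N) (fun _ _ => .of_discrete)
  simp only [Equiv.symm_apply_apply] at h1
  have h2 : {ω | ∀ i, pointCount (A i) (X ω) ∈ N i} =
      ⋂ i ∈ Finset.univ, (fun ω => pointCount (A i) (X ω)) ⁻¹' N i := by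
    ext ω
    simp
  rw [h2, h1]
  exact Finset.prod_congr rfl fun i _ => h.measure_pointCount_eq (hA i) (N i)

lemma IsPoissonProcess.measure_void_compl_and_forall {ι : Type*} [Fintype ι]
    (h : IsPoissonProcess ν lam X P) {B : ι → Set S} (hB : ∀ i, MeasurableSet (B i))
    (hd : Pairwise fun i j => Disjoint (B i) (B j)) (N : ι → Set ℕ) :
    P {ω | X ω ∈ voidEvent (⋃ i, B i)ᶜ ∧ ∀ i, pointCount (B i) (X ω) ∈ N i} =
      poissonMeasure (meanCount ν lam (⋃ i, B i)ᶜ).toNNReal {0} *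
        ∏ i, poissonMeasure (meanCount ν lam (B i)).toNNReal (N i) := by
  have h1 := h.measure_forall_pointCount_mem
    (A := fun i : Option ι => i.elim (⋃ i, B i)ᶜ B)
    (Option.rec (MeasurableSet.iUnion hB).compl hB) ?_ (fun i => i.elim {0} N)
  · rw [Fintype.prod_option] at h1
    simp only [Option.elim_none, Option.elim_some] at h1
    rw [← h1]
    congr 1
    ext ω
    simp [Option.forall, pointCount_eq_zero_iff]
  · have h0 : ∀ i, Disjoint (B i) (⋃ i, B i)ᶜ := fun i =>
      Set.disjoint_compl_right_iff_subset.2 (Set.subset_iUnion B i)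
    rintro (_ | i) (_ | j) hij
    · exact absurd rfl hij
    · exact (h0 j).symm
    · exact h0 i
    · exact hd fun h => hij (by rw [h])

lemma IsPoissonProcess.isFiniteMeasure_withDensity (h : IsPoissonProcess ν lam X P) :
    IsFiniteMeasure (ν.withDensity fun ζ => (lam ζ : ℝ≥0∞)) := by
  refine MeasureTheory.isFiniteMeasure_withDensity ?_
  have := h.meanCount_ne_top Set.univ
  rwa [meanCount, Measure.restrict_univ] at this

variable [MetricSpace S] [BorelSpace S]

lemma IsPoissonProcess.map_closedBallOf_dH (h : IsPoissonProcess ν lam X P) (hX : Measurable X)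
    (x : Configuration S) [Fintype x.points] {δ : ℝ} (hδ : 0 ≤ δ)
    (hd : Pairwise fun a b : x.points =>
      Disjoint (Metric.closedBall (a : S) δ) (Metric.closedBall (b : S) δ)) :
    P.map X (closedBallOf dH x δ) =
      poissonMeasure (meanCount ν lam (⋃ a : x.points, Metric.closedBall (a : S) δ)ᶜ).toNNReal {0} *
        ∏ a : x.points,
          poissonMeasure (meanCount ν lam (Metric.closedBall (a : S) δ)).toNNReal {0}ᶜ := by
  rw [Measure.map_apply hX (measurableSet_closedBallOf_dH x hδ),
    ← h.measure_void_compl_and_forall (fun _ => Metric.isClosed_closedBall.measurableSet) hd]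
  congr 1
  ext ω
  exact mem_closedBallOf_dH_iff hδ

/-- In a small Hausdorff ball around `x`, configurations with more points than `x` have a small
relative probability. -/
lemma IsPoissonProcess.map_closedBallOf_inter_le (h : IsPoissonProcess ν lam X P)
    (hX : Measurable X) (x : Configuration S) [Fintype x.points] {δ : ℝ} (hδ : 0 ≤ δ)
    (hd : Pairwise fun a b : x.points =>
      Disjoint (Metric.closedBall (a : S) δ) (Metric.closedBall (b : S) δ)) :
    P.map X (closedBallOf dH x δ ∩ {y | numPoints y ≠ numPoints x}) ≤
      (∑ a : x.points, meanCount ν lam (Metric.closedBall (a : S) δ)) *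
        P.map X (closedBallOf dH x δ) := by
  classical
  let B : x.points → Set S := fun a => Metric.closedBall (a : S) δ
  have hB : ∀ a, MeasurableSet (B a) := fun a => Metric.isClosed_closedBall.measurableSet
  let N : x.points → x.points → Set ℕ := fun a => Function.update (fun _ => {0}ᶜ) a (Set.Ici 2)
  let E : x.points → Set (Configuration S) := fun a =>
    voidEvent (⋃ a, B a)ᶜ ∩ ⋂ b, pointCount (B b) ⁻¹' N a b
  have hE : ∀ a, MeasurableSet (E a) := fun a =>
    (measurableSet_voidEvent (MeasurableSet.iUnion hB).compl).inter
      (MeasurableSet.iInter fun b => measurable_pointCount (hB b) .of_discrete)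
  have hsub : closedBallOf dH x δ ∩ {y | numPoints y ≠ numPoints x} ⊆ ⋃ a, E a := by
    rintro y ⟨hy, hne⟩
    obtain ⟨hy0, hy1⟩ := (mem_closedBallOf_dH_iff hδ).1 hy
    obtain ⟨a, ha⟩ : ∃ a, pointCount (B a) y ≠ 1 := by
      by_contra! hall
      exact hne (numPoints_eq_of_pointCount_eq_one hd hy0 hall)
    refine Set.mem_iUnion.2 ⟨a, hy0, Set.mem_iInter.2 fun b => ?_⟩
    rcases eq_or_ne b a with rfl | hb
    · have := hy1 b
      simp only [Set.mem_preimage, N, Function.update_self, Set.mem_Ici]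
      change pointCount (B b) y ≠ 0 at this
      omega
    · simpa [N, Function.update_of_ne hb] using hy1 b
  have hEle : ∀ a, P.map X (E a) ≤ meanCount ν lam (B a) * P.map X (closedBallOf dH x δ) := by
    intro a
    have h1 : P.map X (E a) = P {ω | X ω ∈ voidEvent (⋃ i, B i)ᶜ ∧
        ∀ i, pointCount (B i) (X ω) ∈ N a i} := by
      rw [Measure.map_apply hX (hE a)]
      congr 1
      ext ω
      simp [E]
    rw [h1, h.measure_void_compl_and_forall hB hd, h.map_closedBallOf_dH hX x hδ hd,
      ← Finset.mul_prod_erase _ _ (Finset.mem_univ a), ← Finset.mul_prod_erase _ _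
        (Finset.mem_univ a), mul_left_comm (meanCount ν lam (B a))]
    refine mul_le_mul' le_rfl ?_
    rw [← mul_assoc]
    refine mul_le_mul' ?_ (Finset.prod_le_prod' fun b hb => ?_)
    · simp only [N, Function.update_self]
      refine (poissonMeasure_Ici_two_le _).trans_eq ?_
      rw [ENNReal.coe_toNNReal (h.meanCount_ne_top _)]
    · simp only [N, Function.update_of_ne (Finset.ne_of_mem_erase hb)]
      exact le_rfl
  calc _ ≤ P.map X (⋃ a, E a) := measure_mono hsub
    _ ≤ ∑ a, P.map X (E a) := measure_iUnion_fintype_le _ _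
    _ ≤ ∑ a, meanCount ν lam (B a) * P.map X (closedBallOf dH x δ) :=
      Finset.sum_le_sum fun a _ => hEle a
    _ = _ := by rw [Finset.sum_mul]

lemma tendsto_meanCount_closedBall (hν : ∀ ζ, ν {ζ} = 0)
    [IsFiniteMeasure (ν.withDensity fun ζ => (lam ζ : ℝ≥0∞))] (a : S) :
    Tendsto (fun δ => meanCount ν lam (Metric.closedBall a δ)) (𝓝[>] 0) (𝓝 0) := by
  have hmeas : ∀ δ, MeasurableSet (Metric.closedBall a δ) :=
    fun δ => Metric.isClosed_closedBall.measurableSet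
  have h := tendsto_measure_biInter_gt (μ := ν.withDensity fun ζ => (lam ζ : ℝ≥0∞))
    (s := fun δ : ℝ => Metric.closedBall a δ) (a := 0) (fun δ _ => (hmeas δ).nullMeasurableSet)
    (fun i j _ hij => Metric.closedBall_subset_closedBall hij) ⟨1, one_pos, measure_ne_top _ _⟩
  have h0 : ⋂ r > (0 : ℝ), Metric.closedBall a r = {a} := by
    ext z
    simp only [Set.mem_iInter, Metric.mem_closedBall, Set.mem_singleton_iff]
    refine ⟨fun hz => dist_le_zero.1 (le_of_forall_gt_imp_ge_of_dense hz), ?_⟩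
    rintro rfl r hr
    simpa using le_of_lt hr
  rw [h0, withDensity_absolutelyContinuous _ _ (hν a)] at h
  refine h.congr fun δ => ?_
  rw [Function.comp_apply, withDensity_apply _ (hmeas δ), meanCount]

lemma IsPoissonProcess.ae_map_closedBallOf_pos [TopologicalSpace.SeparableSpace S]
    (h : IsPoissonProcess ν lam X P) (hX : Measurable X) :
    ∀ᵐ x ∂(P.map X), ∀ δ : ℝ, 0 < δ → 0 < P.map X (closedBallOf dH x δ) := by
  have : SecondCountableTopology S := UniformSpace.secondCountable_of_separable S
  set m := ν.withDensity fun ζ => (lam ζ : ℝ≥0∞) with hm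
  have hsupp : MeasurableSet m.supportᶜ := m.isOpen_compl_support.measurableSet
  -- almost surely no point lies outside the support of the mean measure
  have hvoid : P.map X (voidEvent m.supportᶜ)ᶜ = 0 := by
    have h1 : X ⁻¹' (voidEvent m.supportᶜ)ᶜ =
        {ω | pointCount m.supportᶜ (X ω) ∈ ({0}ᶜ : Set ℕ)} := by
      ext ω
      simp [pointCount_eq_zero_iff]
    have h2 : meanCount ν lam m.supportᶜ = 0 := by
      rw [meanCount, ← withDensity_apply _ hsupp, ← hm]
      exact Measure.measure_compl_support
    rw [Measure.map_apply hX (measurableSet_voidEvent hsupp).compl, h1,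
      h.measure_pointCount_eq hsupp, h2, poissonMeasure_compl_zero]
    simp
  filter_upwards [measure_eq_zero_iff_ae_notMem.1 hvoid] with x hx δ hδ
  rw [Set.notMem_compl_iff, voidEvent, Set.mem_ofPred_eq,
    Set.disjoint_compl_right_iff_subset] at hx
  have : Fintype x.points := x.finite.fintype
  obtain ⟨δ', hd, hδ'⟩ := ((eventually_disjoint_closedBall x).and (Ioo_mem_nhdsGT hδ)).exists
  refine lt_of_lt_of_le ?_ (measure_mono (closedBallOf_mono dH x hδ'.2.le))
  rw [h.map_closedBallOf_dH hX x hδ'.1.le hd]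
  refine ENNReal.mul_pos ?_ (Finset.prod_ne_zero_iff.2 fun a _ => ?_)
  · rw [poissonMeasure_singleton]
    simp [Real.exp_pos]
  · have hpos := (Measure.mem_support_iff_forall _).1 (hx a.2) _
      (Metric.closedBall_mem_nhds (a : S) hδ'.1)
    rw [hm, withDensity_apply _ Metric.isClosed_closedBall.measurableSet] at hpos
    have := ENNReal.toNNReal_pos (ne_of_gt hpos) (h.meanCount_ne_top _)
    rw [poissonMeasure_compl_zero]
    simpa [meanCount] using this

end Poisson

/-! ### From local estimates to the Besicovitch condition -/

section Besicovitch

variable {S : Type*} [MetricSpace S] [MeasurableSpace S] [BorelSpace S]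

omit [MetricSpace S] [BorelSpace S] in
lemma measurable_numPoints : Measurable (numPoints : Configuration S → ℕ) := by
  have h : (numPoints : Configuration S → ℕ) = pointCount Set.univ := by
    ext x
    simp [numPoints, pointCount]
  rw [h]
  exact measurable_pointCount MeasurableSet.univ

/-- A bounded function that is continuous at `x` along configurations with as many points as `x`
has vanishing mean deviation at `x`, when the other configurations are asymptotically negligible
in small balls around `x`. -/
lemma tendsto_meanDeviation {Q : Measure (Configuration S)} [IsFiniteMeasure Q]
    {η r : Configuration S → ℝ} (hr : η =ᵐ[Q] r) {K : ℝ} (hK : ∀ y, |r y| ≤ K)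
    {x : Configuration S} (hx : η x = r x) (hcont : Tendsto r (nhdsSameCard x) (𝓝 (r x)))
    {c : ℝ → ℝ≥0∞} (hc : Tendsto c (𝓝[>] 0) (𝓝 0))
    (hQ : ∀ᶠ δ in 𝓝[>] (0 : ℝ), Q (closedBallOf dH x δ ∩ {y | numPoints y ≠ numPoints x}) ≤
      c δ * Q (closedBallOf dH x δ)) :
    Tendsto (meanDeviation dH Q η x) (𝓝[>] 0) (𝓝 0) := by
  refine ENNReal.tendsto_nhds_zero.2 fun ε hε => ?_
  obtain ⟨e, he, heε⟩ := ENNReal.lt_iff_exists_nnreal_btwn.1 (ENNReal.half_pos hε.ne')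
  have he' : (0 : ℝ) < e := by exact_mod_cast he
  obtain ⟨δ₀, hδ₀, hnear⟩ :=
    exists_of_eventually_nhdsSameCard (hcont (Metric.ball_mem_nhds (r x) he'))
  have hKc : Tendsto (fun δ => ENNReal.ofReal (2 * K) * c δ) (𝓝[>] 0) (𝓝 0) := by
    simpa only [mul_zero] using ENNReal.Tendsto.const_mul hc (Or.inr ENNReal.ofReal_ne_top)
  filter_upwards [hQ, Ioo_mem_nhdsGT hδ₀,
    ENNReal.tendsto_nhds_zero.1 hKc _ (ENNReal.half_pos hε.ne')] with δ hδ hδ' hcδ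
  have hD : MeasurableSet {y : Configuration S | numPoints y ≠ numPoints x} :=
    measurable_numPoints (.of_discrete (s := {numPoints x}ᶜ))
  have hB := measurableSet_closedBallOf_dH x hδ'.1.le
  refine ENNReal.div_le_of_le_mul ?_
  calc ∫⁻ y in closedBallOf dH x δ, ENNReal.ofReal |η x - η y| ∂Q
      = ∫⁻ y in closedBallOf dH x δ, ENNReal.ofReal |r x - r y| ∂Q := by
        refine lintegral_congr_ae (ae_restrict_of_ae ?_)
        filter_upwards [hr] with y hy
        rw [hx, hy]
    _ ≤ ∫⁻ y in closedBallOf dH x δ, ((e : ℝ≥0∞) +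
          {y | numPoints y ≠ numPoints x}.indicator (fun _ => ENNReal.ofReal (2 * K)) y) ∂Q := by
        refine setLIntegral_mono' hB fun y hy => ?_
        by_cases hn : numPoints y = numPoints x
        · have h1 := hnear y (closedBallOf_mono dH x hδ'.2.le hy) hn
          rw [Metric.mem_ball, dist_comm, Real.dist_eq] at h1
          refine le_add_right ?_
          rw [← ENNReal.ofReal_coe_nnreal]
          exact ENNReal.ofReal_le_ofReal h1.le
        · rw [Set.indicator_of_mem (by exact hn)]
          refine le_add_left (ENNReal.ofReal_le_ofReal ?_)
          linarith [abs_sub (r x) (r y), hK x, hK y]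
    _ = e * Q (closedBallOf dH x δ) + ENNReal.ofReal (2 * K) *
          Q (closedBallOf dH x δ ∩ {y | numPoints y ≠ numPoints x}) := by
        rw [lintegral_add_left measurable_const, lintegral_indicator_const hD,
          Measure.restrict_apply hD, setLIntegral_const, Set.inter_comm]
    _ ≤ e * Q (closedBallOf dH x δ) + ENNReal.ofReal (2 * K) *
          (c δ * Q (closedBallOf dH x δ)) := by gcongr
    _ = (e + ENNReal.ofReal (2 * K) * c δ) * Q (closedBallOf dH x δ) := by ring
    _ ≤ (ε / 2 + ε / 2) * Q (closedBallOf dH x δ) := by gcongr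
    _ = ε * Q (closedBallOf dH x δ) := by rw [ENNReal.add_halves]

lemma besicovitchCondition_of_ae_tendsto {E : Type*} [MeasurableSpace E] {d : E → E → ℝ≥0∞}
    {Q : Measure E} {η : E → ℝ} (hpos : ∀ᵐ x ∂Q, ∀ δ : ℝ, 0 < δ → 0 < Q (closedBallOf d x δ))
    (h : ∀ᵐ x ∂Q, Tendsto (meanDeviation d Q η x) (𝓝[>] 0) (𝓝 0)) :
    BesicovitchCondition d Q η := by
  refine ⟨?_, ?_⟩
  · filter_upwards [hpos, h] with x hx h0
    exact ⟨hx, 0, h0⟩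
  · refine tendsto_const_nhds.congr fun ε => (measure_eq_zero_iff_ae_notMem.2 ?_).symm
    filter_upwards [h] with x h0
    rintro ⟨L, hL, hεL⟩
    rw [tendsto_nhds_unique hL h0] at hεL
    exact not_lt_zero hεL

end Besicovitch

/-! ### The regression function -/

section Regression

lemma exists_sFinite_lintegral_eq {S : Type*} [MeasurableSpace S] {ν : Measure S}
    (hν : ∀ ζ, ν {ζ} = 0) {f : S → ℝ≥0} (hf : Measurable f) (hfin : ∫⁻ ζ, f ζ ∂ν ≠ ∞) :
    ∃ μ : Measure S, SFinite μ ∧ (∀ ζ, μ {ζ} = 0) ∧ ∀ g : S → ℝ≥0, Measurable g → g ≤ f →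
      ∀ A, MeasurableSet A → ∫⁻ ζ in A, g ζ ∂μ = meanCount ν g A := by
  have : IsFiniteMeasure (ν.withDensity fun ζ => (f ζ : ℝ≥0∞)) :=
    isFiniteMeasure_withDensity hfin
  -- `μ` is the restriction of `ν` to `{f ≠ 0}`
  refine ⟨(ν.withDensity fun ζ => (f ζ : ℝ≥0∞)).withDensity fun ζ => (f ζ : ℝ≥0∞)⁻¹,
    inferInstance, fun ζ => ?_, fun g hg hgf A hA => ?_⟩
  · exact withDensity_absolutelyContinuous _ _ (withDensity_absolutelyContinuous _ _ (hν ζ))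
  · have hf' := hf.coe_nnreal_ennreal
    have hf'' : Measurable fun ζ => (f ζ : ℝ≥0∞)⁻¹ := hf'.inv
    have hg' := hg.coe_nnreal_ennreal
    rw [setLIntegral_withDensity_eq_setLIntegral_mul _ hf'' hg' hA,
      setLIntegral_withDensity_eq_setLIntegral_mul _ hf' (hf''.mul hg') hA, meanCount]
    refine lintegral_congr fun ζ => ?_
    simp only [Pi.mul_apply]
    by_cases h0 : f ζ = 0
    · simp [h0, le_antisymm ((hgf ζ).trans_eq h0) zero_le]
    · rw [← mul_assoc, ENNReal.mul_inv_cancel (by simpa using h0) ENNReal.coe_ne_top, one_mul]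

lemma setLIntegral_comp_eq_sum {Ω ι : Type*} [MeasurableSpace Ω] [Fintype ι] [MeasurableSpace ι]
    [MeasurableSingletonClass ι] {P : Measure Ω} {Y : Ω → ι} (hY : Measurable Y) (f : ι → ℝ≥0)
    {A : Set Ω} (hA : MeasurableSet A) :
    ∫⁻ ω in A, f (Y ω) ∂P = ∑ j, f j * P.restrict (Y ⁻¹' {j}) A := by
  rw [← lintegral_map (f := fun j => (f j : ℝ≥0∞)) .of_discrete hY, lintegral_fintype]
  refine Finset.sum_congr rfl fun j _ => ?_
  have hj := hY (measurableSet_singleton j)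
  rw [Measure.map_apply hY (measurableSet_singleton j), Measure.restrict_apply hj,
    Measure.restrict_apply hA, Set.inter_comm]

/-- The posterior mean `∑ j, f j * D j / ∑ j, D j` of `f` under the weights `D j x`; it is `0` where
all the weights vanish. -/
noncomputable def posteriorMean {E ι : Type*} [Fintype ι] (f : ι → ℝ≥0) (D : ι → E → ℝ≥0)
    (x : E) : ℝ≥0 :=
  (∑ j, f j * D j x) / ∑ j, D j x

lemma posteriorMean_mul {E ι : Type*} [Fintype ι] (f : ι → ℝ≥0) (D : ι → E → ℝ≥0) (x : E) :
    posteriorMean f D x * ∑ j, D j x = ∑ j, f j * D j x := by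
  by_cases h0 : ∑ j, D j x = 0
  · rw [h0, mul_zero, eq_comm]
    refine Finset.sum_eq_zero fun j hj => ?_
    rw [Finset.sum_eq_zero_iff.1 h0 j hj, mul_zero]
  · exact div_mul_cancel₀ _ h0

lemma posteriorMean_le {E ι : Type*} [Fintype ι] (f : ι → ℝ≥0) (D : ι → E → ℝ≥0) (x : E) :
    posteriorMean f D x ≤ ∑ j, f j := by
  refine div_le_of_le_mul₀ zero_le zero_le ?_
  rw [Finset.mul_sum]
  refine Finset.sum_le_sum fun j hj => ?_
  gcongr
  exact Finset.single_le_sum (f := f) (fun _ _ => zero_le) hj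

lemma measurable_posteriorMean {E ι : Type*} [MeasurableSpace E] [Fintype ι] (f : ι → ℝ≥0)
    {D : ι → E → ℝ≥0} (hD : ∀ j, Measurable (D j)) : Measurable (posteriorMean f D) := by
  unfold posteriorMean
  fun_prop

lemma map_eq_withDensity_sum {Ω E ι : Type*} [MeasurableSpace Ω] [MeasurableSpace E]
    [Fintype ι] [MeasurableSpace ι] [MeasurableSingletonClass ι] {P : Measure Ω}
    {X : Ω → E} {Y : Ω → ι} (hX : Measurable X) (hY : Measurable Y)
    {R : Measure E} {D : ι → E → ℝ≥0} (hD : ∀ j, Measurable (D j))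
    (hlaw : ∀ j, (P.restrict (Y ⁻¹' {j})).map X = R.withDensity fun x => (D j x : ℝ≥0∞)) :
    P.map X = R.withDensity fun x => ((∑ j, D j x : ℝ≥0) : ℝ≥0∞) := by
  ext B hB
  have h1 := setLIntegral_comp_eq_sum (P := P) hY (fun _ => 1) (hX hB)
  simp only [ENNReal.coe_one, one_mul, setLIntegral_one] at h1
  rw [Measure.map_apply hX hB, h1, withDensity_apply _ hB]
  push_cast
  rw [lintegral_finsetSum _ fun j _ => (hD j).coe_nnreal_ennreal]
  refine Finset.sum_congr rfl fun j _ => ?_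
  rw [← withDensity_apply _ hB, ← hlaw, Measure.map_apply hX hB]

/-- Bayes' formula: when the law of `X` on the event `{Y = j}` has the density `D j` with respect to
a common measure, the regression function of `f Y` is the posterior mean of `f`. -/
lemma posteriorMean_ae_eq_condExp {Ω E ι : Type*} [MeasurableSpace Ω] [mE : MeasurableSpace E]
    [Fintype ι] [MeasurableSpace ι] [MeasurableSingletonClass ι] {P : Measure Ω}
    [IsProbabilityMeasure P] {X : Ω → E} {Y : Ω → ι} (hX : Measurable X) (hY : Measurable Y)
    {R : Measure E} {D : ι → E → ℝ≥0} (hD : ∀ j, Measurable (D j))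
    (hlaw : ∀ j, (P.restrict (Y ⁻¹' {j})).map X = R.withDensity fun x => (D j x : ℝ≥0∞))
    (f : ι → ℝ≥0) :
    (fun ω => (posteriorMean f D (X ω) : ℝ)) =ᵐ[P]
      P[fun ω => (f (Y ω) : ℝ) | MeasurableSpace.comap X mE] := by
  set r : E → ℝ≥0 := posteriorMean f D with hr
  have hrm : Measurable r := measurable_posteriorMean f hD
  have hint : ∀ B, MeasurableSet B →
      ∫⁻ ω in X ⁻¹' B, r (X ω) ∂P = ∫⁻ ω in X ⁻¹' B, f (Y ω) ∂P := by
    intro B hB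
    rw [setLIntegral_comp_eq_sum hY f (hX hB),
      ← setLIntegral_map hB hrm.coe_nnreal_ennreal hX,
      map_eq_withDensity_sum hX hY hD hlaw,
      setLIntegral_withDensity_eq_setLIntegral_mul _ (by fun_prop) hrm.coe_nnreal_ennreal hB]
    have h1 : ∀ x, ((fun x => ((∑ j, D j x : ℝ≥0) : ℝ≥0∞)) * fun x => (r x : ℝ≥0∞)) x =
        ∑ j, (f j : ℝ≥0∞) * D j x := by
      intro x
      rw [Pi.mul_apply, ← ENNReal.coe_mul, mul_comm, posteriorMean_mul]
      push_cast
      rfl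
    simp only [h1]
    rw [lintegral_finsetSum _ fun j _ => (hD j).coe_nnreal_ennreal.const_mul _]
    refine Finset.sum_congr rfl fun j _ => ?_
    rw [lintegral_const_mul _ (hD j).coe_nnreal_ennreal, ← withDensity_apply _ hB, ← hlaw,
      Measure.map_apply hX hB]
  have hYm : Measurable fun ω => (f (Y ω) : ℝ) :=
    (Measurable.of_discrete (f := fun j => (f j : ℝ))).comp hY
  have hrX : Measurable fun ω => (r (X ω) : ℝ) := (hrm.comp hX).coe_nnreal_real
  have bounded : ∀ u : Ω → ℝ≥0, Measurable (fun ω => (u ω : ℝ)) → (∀ ω, u ω ≤ ∑ j, f j) →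
      Integrable (fun ω => (u ω : ℝ)) P := by
    intro u hu huK
    refine Integrable.of_bound hu.aestronglyMeasurable ((∑ j, f j : ℝ≥0) : ℝ) ?_
    refine .of_forall fun ω => ?_
    rw [Real.norm_of_nonneg (u ω).coe_nonneg]
    exact_mod_cast huK ω
  have hYint := bounded (fun ω => f (Y ω)) hYm fun ω =>
    Finset.single_le_sum (f := f) (fun _ _ => zero_le) (Finset.mem_univ _)
  have hrint := bounded (fun ω => r (X ω)) hrX fun ω => posteriorMean_le f D _
  refine ae_eq_condExp_of_forall_setIntegral_eq hX.comap_le hYint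
    (fun _ _ _ => hrint.integrableOn) ?_ ?_
  · rintro _ ⟨B, hB, rfl⟩ -
    rw [integral_eq_lintegral_of_nonneg_ae (.of_forall fun ω => (r (X ω)).coe_nonneg)
      hrX.aestronglyMeasurable, integral_eq_lintegral_of_nonneg_ae
      (.of_forall fun ω => (f (Y ω)).coe_nonneg) hYm.aestronglyMeasurable]
    simp only [ENNReal.ofReal_coe_nnreal, hint B hB]
  · exact (hrm.coe_nnreal_real.comp (comap_measurable X)).aestronglyMeasurable

end Regression

/-! ### Mixtures of Poisson processes -/

section Mixture

variable {S Ω ι : Type*} [MetricSpace S] [MeasurableSpace S] [BorelSpace S]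
    [MeasurableSpace Ω] [Fintype ι] [MeasurableSpace ι] [MeasurableSingletonClass ι]
    {ν : Measure S} {P : Measure Ω} [IsProbabilityMeasure P]
    {X : Ω → Configuration S} {Y : Ω → ι} {lam : ι → S → ℝ≥0}

omit [MetricSpace S] [BorelSpace S] in
lemma map_apply_eq_sum_cond (hX : Measurable X) (hY : Measurable Y) {B : Set (Configuration S)}
    (hB : MeasurableSet B) :
    P.map X B = ∑ j with P (Y ⁻¹' {j}) ≠ 0, P (Y ⁻¹' {j}) * (P[|Y ⁻¹' {j}]).map X B := by
  rw [Finset.sum_filter_of_ne fun j _ h => left_ne_zero_of_mul h, Measure.map_apply hX hB]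
  have h := DFunLike.congr_fun (sum_meas_smul_cond_fiber hY P) (X ⁻¹' B)
  rw [← h]
  simp [Measure.map_apply hX hB]

lemma ae_map_closedBallOf_pos_of_mixture [TopologicalSpace.SeparableSpace S]
    (hX : Measurable X) (hY : Measurable Y)
    (hP : ∀ j, P (Y ⁻¹' {j}) ≠ 0 → IsPoissonProcess ν (lam j) X P[|Y ⁻¹' {j}]) :
    ∀ᵐ x ∂(P.map X), ∀ δ : ℝ, 0 < δ → 0 < P.map X (closedBallOf dH x δ) := by
  have key : ∀ j, P (Y ⁻¹' {j}) ≠ 0 → ∀ᵐ x ∂((P[|Y ⁻¹' {j}]).map X),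
      ∀ δ : ℝ, 0 < δ → 0 < P.map X (closedBallOf dH x δ) := by
    intro j hj
    filter_upwards [(hP j hj).ae_map_closedBallOf_pos hX] with x hx δ hδ
    rw [map_apply_eq_sum_cond hX hY (measurableSet_closedBallOf_dH x hδ.le)]
    refine lt_of_lt_of_le (ENNReal.mul_pos hj (hx δ hδ).ne') ?_
    exact Finset.single_le_sum
      (f := fun j => P (Y ⁻¹' {j}) * (P[|Y ⁻¹' {j}]).map X (closedBallOf dH x δ))
      (fun _ _ => zero_le) (by simpa using hj)
  obtain ⟨N, hN⟩ : ∃ N : ι → Set (Configuration S), ∀ j, P (Y ⁻¹' {j}) ≠ 0 →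
      {x | ¬ ∀ δ : ℝ, 0 < δ → 0 < P.map X (closedBallOf dH x δ)} ⊆ N j ∧
        MeasurableSet (N j) ∧ (P[|Y ⁻¹' {j}]).map X (N j) = 0 := by
    refine ⟨fun j => toMeasurable ((P[|Y ⁻¹' {j}]).map X) _, fun j hj =>
      ⟨subset_toMeasurable _ _, measurableSet_toMeasurable _ _, ?_⟩⟩
    rw [measure_toMeasurable]
    exact key j hj
  -- the intersection of the exceptional null sets is a measurable null set
  have hmeas : MeasurableSet (⋂ j, ⋂ _ : P (Y ⁻¹' {j}) ≠ 0, N j) :=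
    .iInter fun j => .iInter fun hj => (hN j hj).2.1
  refine measure_mono_null (t := ⋂ j, ⋂ _ : P (Y ⁻¹' {j}) ≠ 0, N j)
    (Set.subset_iInter₂ fun j hj => (hN j hj).1) ?_
  rw [map_apply_eq_sum_cond hX hY hmeas]
  refine Finset.sum_eq_zero fun j hj => ?_
  have hj' : P (Y ⁻¹' {j}) ≠ 0 := by simpa using hj
  rw [measure_mono_null (Set.iInter₂_subset j hj') (hN j hj').2.2, mul_zero]

lemma exists_map_closedBallOf_inter_le (hν : ∀ ζ, ν {ζ} = 0) (hX : Measurable X)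
    (hY : Measurable Y)
    (hP : ∀ j, P (Y ⁻¹' {j}) ≠ 0 → IsPoissonProcess ν (lam j) X P[|Y ⁻¹' {j}])
    (x : Configuration S) :
    ∃ c : ℝ → ℝ≥0∞, Tendsto c (𝓝[>] 0) (𝓝 0) ∧ ∀ᶠ δ in 𝓝[>] (0 : ℝ),
      P.map X (closedBallOf dH x δ ∩ {y | numPoints y ≠ numPoints x}) ≤
        c δ * P.map X (closedBallOf dH x δ) := by
  have : Fintype x.points := x.finite.fintype
  refine ⟨fun δ => ∑ j with P (Y ⁻¹' {j}) ≠ 0, ∑ a : x.points,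
    meanCount ν (lam j) (Metric.closedBall (a : S) δ), ?_, ?_⟩
  · have h : Tendsto (fun δ => ∑ j with P (Y ⁻¹' {j}) ≠ 0, ∑ a : x.points,
        meanCount ν (lam j) (Metric.closedBall (a : S) δ)) (𝓝[>] 0)
        (𝓝 (∑ j with P (Y ⁻¹' {j}) ≠ 0, ∑ a : x.points, 0)) := by
      refine tendsto_finsetSum _ fun j hj => tendsto_finsetSum _ fun a _ => ?_
      have := (hP j (by simpa using hj)).isFiniteMeasure_withDensity
      exact tendsto_meanCount_closedBall hν (a : S)
    simpa using h
  · filter_upwards [eventually_disjoint_closedBall x, self_mem_nhdsWithin] with δ hd hδ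
    have hB := measurableSet_closedBallOf_dH x (le_of_lt hδ)
    have hD : MeasurableSet {y : Configuration S | numPoints y ≠ numPoints x} :=
      measurable_numPoints (.of_discrete (s := {numPoints x}ᶜ))
    rw [map_apply_eq_sum_cond hX hY (hB.inter hD), map_apply_eq_sum_cond hX hY hB,
      Finset.mul_sum]
    refine Finset.sum_le_sum fun j hj => ?_
    rw [mul_left_comm]
    refine mul_le_mul' le_rfl ?_
    refine ((hP j (by simpa using hj)).map_closedBallOf_inter_le hX x (le_of_lt hδ) hd).trans ?_
    refine mul_le_mul' ?_ le_rfl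
    exact Finset.single_le_sum
      (f := fun j => ∑ a : x.points, meanCount ν (lam j) (Metric.closedBall (a : S) δ))
      (fun _ _ => zero_le) hj

omit [MeasurableSpace ι] [MeasurableSingletonClass ι] in
/-- The conditional Poisson laws of a mixture have, up to constants, the densities
`∏_{ζ ∈ x} lam j ζ` with respect to a single Lebesgue–Poisson measure. -/
lemma exists_map_restrict_eq_withDensity [TopologicalSpace.SeparableSpace S]
    (hν : ∀ ζ, ν {ζ} = 0) (hX : Measurable X) (hlam : ∀ j, Measurable (lam j))
    (hP : ∀ j, P (Y ⁻¹' {j}) ≠ 0 → IsPoissonProcess ν (lam j) X P[|Y ⁻¹' {j}]) :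
    ∃ (R : Measure (Configuration S)) (w : ι → ℝ≥0), ∀ j,
      (P.restrict (Y ⁻¹' {j})).map X =
        R.withDensity fun x => ((w j * pointProd (lam j) x : ℝ≥0) : ℝ≥0∞) := by
  have hf : Measurable fun ζ => ∑ j with P (Y ⁻¹' {j}) ≠ 0, lam j ζ :=
    Finset.measurable_sum _ fun j _ => hlam j
  have hfin : ∫⁻ ζ, ((∑ j with P (Y ⁻¹' {j}) ≠ 0, lam j ζ : ℝ≥0) : ℝ≥0∞) ∂ν ≠ ∞ := by
    push_cast
    rw [lintegral_finsetSum _ fun j _ => (hlam j).coe_nnreal_ennreal]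
    refine ENNReal.sum_ne_top.2 fun j hj => ?_
    have := (hP j (by simpa using hj)).meanCount_ne_top Set.univ
    rwa [meanCount, Measure.restrict_univ] at this
  obtain ⟨μ, hμs, hμ, hmean⟩ := exists_sFinite_lintegral_eq hν hf hfin
  refine ⟨lebesguePoisson μ, fun j => (P (Y ⁻¹' {j})).toNNReal *
    (Real.exp (-(meanCount ν (lam j) Set.univ).toReal)).toNNReal, fun j => ?_⟩
  by_cases hj : P (Y ⁻¹' {j}) = 0
  · simp [hj, Measure.restrict_eq_zero.2 hj]
  have := cond_isProbabilityMeasure hj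
  have h := (hP j hj).map_eq_withDensity hX (hlam j) hμ (hmean _ (hlam j) fun ζ =>
    Finset.single_le_sum (f := fun j => lam j ζ) (fun _ _ => zero_le) (by simpa using hj))
  have hcond : P.restrict (Y ⁻¹' {j}) = P (Y ⁻¹' {j}) • P[|Y ⁻¹' {j}] := by
    rw [ProbabilityTheory.cond, smul_smul, ENNReal.mul_inv_cancel hj (measure_ne_top _ _), one_smul]
  rw [hcond, Measure.map_smul, h,
    ← withDensity_smul _ ((measurable_pointProd (hlam j)).coe_nnreal_ennreal.const_mul _)]
  congr 1
  ext x
  simp only [Pi.smul_apply, smul_eq_mul, ENNReal.coe_mul,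
    ENNReal.coe_toNNReal (measure_ne_top P _), mul_assoc]
  rfl

end Mixture

theorem mainTheorem2 {S Ω : Type*} [MetricSpace S] [TopologicalSpace.SeparableSpace S]
    [MeasurableSpace S] [BorelSpace S] (ν : Measure S) (hν : ∀ ζ : S, ν {ζ} = 0)
    [MeasurableSpace Ω] (P : Measure Ω) [IsProbabilityMeasure P]
    (M : ℕ) (X : Ω → Configuration S) (Y : Ω → Fin (M + 1))
    (hX : Measurable X) (hY : Measurable Y)
    (lam : Fin (M + 1) → S → ℝ≥0) (hlam : ∀ j, Continuous (lam j))
    (hPoisson : ∀ j, P (Y ⁻¹' {j}) ≠ 0 → IsPoissonProcess ν (lam j) X P[|Y ⁻¹' {j}])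
    (η : Configuration S → ℝ)
    (hη : IsRegressionFunction P X (fun ω => ((Y ω : ℕ) : ℝ)) η) :
    BesicovitchCondition dH (P.map X) η := by
  obtain ⟨R, w, hlaw⟩ :=
    exists_map_restrict_eq_withDensity hν hX (fun j => (hlam j).measurable) hPoisson
  set D : Fin (M + 1) → Configuration S → ℝ≥0 := fun j x => w j * pointProd (lam j) x
  have hD : ∀ j, Measurable (D j) := fun j =>
    (measurable_pointProd (hlam j).measurable).const_mul _
  let f : Fin (M + 1) → ℝ≥0 := fun j => ((j : ℕ) : ℝ≥0)
  have hr := measurable_posteriorMean f hD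
  have hηr : η =ᵐ[P.map X] fun x => (posteriorMean f D x : ℝ) := by
    refine (ae_map_iff hX.aemeasurable (measurableSet_eq_fun hη.1 hr.coe_nnreal_real)).2 ?_
    have h := posteriorMean_ae_eq_condExp hX hY hD hlaw f
    simp only [f, NNReal.coe_natCast] at h
    exact hη.2.trans h.symm
  have hpos : ∀ᵐ x ∂(P.map X), ∑ j, D j x ≠ 0 := by
    have hm : Measurable fun x => ((∑ j, D j x : ℝ≥0) : ℝ≥0∞) := by fun_prop
    rw [map_eq_withDensity_sum hX hY hD hlaw, ae_withDensity_iff hm]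
    exact .of_forall fun x hx => by simpa using hx
  have := Measure.isProbabilityMeasure_map (μ := P) hX.aemeasurable
  refine besicovitchCondition_of_ae_tendsto
    (ae_map_closedBallOf_pos_of_mixture hX hY hPoisson) ?_
  filter_upwards [hηr, hpos] with x hx hDx
  obtain ⟨c, hc, hcQ⟩ := exists_map_closedBallOf_inter_le hν hX hY hPoisson x
  have hDt : ∀ j, Tendsto (D j) (nhdsSameCard x) (𝓝 (D j x)) := fun j =>
    (tendsto_pointProd (hlam j) x).const_mul _
  have hcont : Tendsto (posteriorMean f D) (nhdsSameCard x) (𝓝 (posteriorMean f D x)) :=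
    (tendsto_finsetSum _ fun j _ => (hDt j).const_mul _).div
      (tendsto_finsetSum _ fun j _ => hDt j) hDx
  refine tendsto_meanDeviation hηr (K := (∑ j, f j : ℝ≥0)) (fun y => ?_) hx
    (NNReal.tendsto_coe.2 hcont) hc hcQ
  rw [abs_of_nonneg (NNReal.coe_nonneg _)]
  exact_mod_cast posteriorMean_le f D y
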